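/- Theorem. All Boolean algebras have a top $1$ and a bottom $0$, not required to be distinct; $a^*$ denotes the complement of $a$. A \emph{local contact algebra} is a triple $(B,\rho,\mathbb B)$, where $B$ is a Boolean algebra, $\rho$ is a binary relation on $B$ and $\mathbb B\subseteq B$, such that, writing $a\ll_\rho b$ for "not $a\rho b^*$", for all $a,b,c\in B$: (C1) $a\neq 0$ implies $a\rho a$; (C2) $a\rho b$ implies $a\ne0$ and $b\neq 0$; (C3) $a\rho b$ implies $b\rho a$; (C4) $a\rho(b\vee c)$ iff $a\rho b$ or $a\rho c$; (BB1) $0\in\mathbb B$; (BB2) $a\le b\in\mathbb B$ implies $a\in\mathbb B$; (BB3) $a,b\in\mathbb B$ implies $a\vee b\in\mathbb B$; (BC1) if $a\in\mathbb B$ and $a\ll_\rho c$, then $a\ll_\rho b\ll_\rho c$ for some $b\in\mathbb B$; (BC2) if $a\rho b$, then $a\rho(c\wedge b)$ for some $c\in\mathbb B$; (BC3) if $a\ne0$, then there is $b\in\mathbb B\setminus\{0\}$ with $b\ll_\rho a$. An \emph{MVD-algebra} is a triple $(B,\le,\ll)$, where $(B,\le)$ is a Boolean algebra and $\ll$ is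 a binary relation on $B$ such that for all $a,b,c,t\in B$: ($\ll$1) $a\ll b$ implies $a\le b$; ($\ll$2) $0\ll0$; ($\ll$3) $a\le b\ll c\le t$ implies $a\ll t$; ($\ll$4) $a\ll c$ and $b\ll c$ imply $a\vee b\ll c$; ($\ll 4^*$) $a\ll b$ and $a\ll c$ imply $a\ll b\wedge c$; ($\ll$5) $a\ll c$ implies $a\ll b\ll c$ for some $b\in B$; ($\ll$6) if $a\ne0$ then $b\ll a$ for some $b\neq0$; (MVD) if $a\ll1$ and $b^*\ll a^*$ then $a\ll b$. Either kind of algebra is \emph{complete} if the Boolean algebra $B$ is complete. A complete Boolean homomorphism $\varphi:A\to B$ (a Boolean homomorphism preserving all joins and all meets) between complete Boolean algebras has a lower adjoint $\varphi_\Lambda:B\to A$, characterized by $\varphi_\Lambda(b)\le a\iff b\le\varphi(a)$. Let $\mathbf{SKAL}$ be the category whose objects are the complete local contact algebras and whose morphisms $(A,\rho,\mathbb B)\to(B,\eta,\mathbb B')$ are the complete Boolean homomorphisms $\varphi:A\to B$ such that (L1) for all $a,b\in A$, $\varphi(a)\,\eta\,\varphi(b)$ implies $a\rho b$; (L2) for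 all $b\in B$, $b\in\mathbb B'$ implies $\varphi_\Lambda(b)\in\mathbb B$. Let $\mathbf{IKA}$ be the category whose objects are the complete MVD-algebras and whose morphisms $(B,\le,\ll)\to(B',\le',\ll')$ are the complete Boolean homomorphisms $\varphi:B\to B'$ such that (S1) for all $a,b\in B$, if $c\wedge a\ll c^*\vee b$ for every $c\in B$ with $c\ll1$, then $d\wedge\varphi(a)\ll' d^*\vee\varphi(b)$ for every $d\in B'$ with $d\ll'1$; (S2) for all $b\in B'$, $b\ll'1$ implies $\varphi_\Lambda(b)\ll1$. Let $\mathbf{SKLC}$ be the category of locally compact Hausdorff spaces and continuous skeletal maps, where $f:X\to Y$ is \emph{skeletal} if $\operatorname{int}(\operatorname{cl}(f(U)))\neq\emptyset$ for every non-empty open $U\subseteq X$. In all three categories composition is the usual composition of functions. Then the categories $\mathbf{SKAL}$ and $\mathbf{IKA}$ are isomorphic; hence the categories $\mathbf{SKLC}$ and $\mathbf{IKA}$ are dually equivalent. -/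

import Mathlib

open CategoryTheory

universe u

namespace RegionBased

/-! ### Contact, local contact and MVD structures on a Boolean algebra -/

/-- `C` is a contact relation on the Boolean algebra `B`. -/
structure IsContact {B : Type u} [BooleanAlgebra B] (C : B → B → Prop) : Prop where
  refl_of_ne_bot : ∀ a, a ≠ ⊥ → C a a
  ne_bot : ∀ a b, C a b → a ≠ ⊥ ∧ b ≠ ⊥
  symm : ∀ a b, C a b → C b a
  sup_iff : ∀ a b c, C a (b ⊔ c) ↔ (C a b ∨ C a c)

/-- Non-tangential inclusion `a ≪_C b`: `a` is not in contact with the complement of `b`. -/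
def nonTangential {B : Type u} [BooleanAlgebra B] (C : B → B → Prop) (a b : B) : Prop :=
  ¬ C a bᶜ

/-- `(B, ρ, bdd)` is a local contact algebra, with `bdd` the set of bounded elements. -/
structure IsLocalContact {B : Type u} [BooleanAlgebra B] (ρ : B → B → Prop) (bdd : Set B) :
    Prop where
  contact : IsContact ρ
  bot_mem : ⊥ ∈ bdd
  mem_of_le : ∀ a b, a ≤ b → b ∈ bdd → a ∈ bdd
  sup_mem : ∀ a b, a ∈ bdd → b ∈ bdd → a ⊔ b ∈ bdd
  interpolate : ∀ a c, a ∈ bdd → nonTangential ρ a c →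
    ∃ b ∈ bdd, nonTangential ρ a b ∧ nonTangential ρ b c
  exists_bounded_contact : ∀ a b, ρ a b → ∃ c ∈ bdd, ρ a (c ⊓ b)
  exists_bounded_inside : ∀ a, a ≠ ⊥ → ∃ b ∈ bdd, b ≠ ⊥ ∧ nonTangential ρ b a

/-- `(B, ≤, ll)` is an MVD-algebra. -/
structure IsMVD {B : Type u} [BooleanAlgebra B] (ll : B → B → Prop) : Prop where
  le_of_ll : ∀ a b, ll a b → a ≤ b
  bot_ll_bot : ll ⊥ ⊥
  mono : ∀ a b c t, a ≤ b → ll b c → c ≤ t → ll a t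
  sup_ll : ∀ a b c, ll a c → ll b c → ll (a ⊔ b) c
  interpolate : ∀ a c, ll a c → ∃ b, ll a b ∧ ll b c
  exists_inside : ∀ a, a ≠ ⊥ → ∃ b, b ≠ ⊥ ∧ ll b a
  ll_inf : ∀ a b c, ll a b → ll a c → ll a (b ⊓ c)
  mvd : ∀ a b, ll a ⊤ → ll bᶜ aᶜ → ll a b

/-! ### Lower adjoints

A complete Boolean homomorphism is a map preserving all joins and meets, that is, a
`CompleteLatticeHom` between complete Boolean algebras; it then preserves `⊥`, `⊤` and
complements. -/

/-- The lower adjoint `φ_Λ` of a complete homomorphism `φ : A → B`. -/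
def lowerAdjoint {A B : Type u} [CompleteBooleanAlgebra A] [CompleteBooleanAlgebra B]
    (φ : CompleteLatticeHom A B) (b : B) : A :=
  sInf {a | b ≤ φ a}

/-- The defining property of the lower adjoint: `φ_Λ b ≤ a ↔ b ≤ φ a`. -/
theorem lowerAdjoint_gc {A B : Type u} [CompleteBooleanAlgebra A] [CompleteBooleanAlgebra B]
    (φ : CompleteLatticeHom A B) : GaloisConnection (lowerAdjoint φ) φ := by
  intro b a
  constructor
  · intro h
    refine le_trans ?_ (OrderHomClass.mono φ h)
    rw [lowerAdjoint, map_sInf]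
    refine le_sInf ?_
    rintro _ ⟨a, ha, rfl⟩
    exact ha
  · intro h
    exact sInf_le h

theorem lowerAdjoint_id {A : Type u} [CompleteBooleanAlgebra A] (a : A) :
    lowerAdjoint (CompleteLatticeHom.id A) a = a :=
  (lowerAdjoint_gc (CompleteLatticeHom.id A)).l_unique GaloisConnection.id (fun _ => rfl)

theorem lowerAdjoint_comp {A B C : Type u} [CompleteBooleanAlgebra A]
    [CompleteBooleanAlgebra B] [CompleteBooleanAlgebra C] (ψ : CompleteLatticeHom B C)
    (φ : CompleteLatticeHom A B) (c : C) :
    lowerAdjoint (ψ.comp φ) c = lowerAdjoint φ (lowerAdjoint ψ c) :=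
  (lowerAdjoint_gc (ψ.comp φ)).l_unique
    ((lowerAdjoint_gc ψ).compose (lowerAdjoint_gc φ)) (fun _ => rfl)

/-! ### The category of complete local contact algebras -/

/-- Complete local contact algebras. -/
structure SKAL : Type (u + 1) where
  carrier : Type u
  [str : CompleteBooleanAlgebra carrier]
  rel : carrier → carrier → Prop
  bdd : Set carrier
  isLocalContact : IsLocalContact rel bdd

attribute [instance] SKAL.str

namespace SKAL

/-- Complete Boolean homomorphisms reflecting contact, whose lower adjoint preserves
boundedness. -/
@[ext]
structure Hom (A B : SKAL.{u}) : Type u where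
  toHom : CompleteLatticeHom A.carrier B.carrier
  contact_of_map : ∀ a b, B.rel (toHom a) (toHom b) → A.rel a b
  lowerAdjoint_mem : ∀ b, b ∈ B.bdd → lowerAdjoint toHom b ∈ A.bdd

instance : Category.{u} SKAL.{u} where
  Hom := Hom
  id A :=
    { toHom := CompleteLatticeHom.id A.carrier
      contact_of_map := fun _ _ h => h
      lowerAdjoint_mem := fun b hb => by rwa [lowerAdjoint_id] }
  comp f g :=
    { toHom := g.toHom.comp f.toHom
      contact_of_map := fun a b h => f.contact_of_map a b (g.contact_of_map _ _ h)
      lowerAdjoint_mem := fun b hb => by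
        rw [lowerAdjoint_comp]
        exact f.lowerAdjoint_mem _ (g.lowerAdjoint_mem b hb) }

end SKAL

/-! ### The category of complete MVD-algebras -/

/-- Complete MVD-algebras. -/
structure IKA : Type (u + 1) where
  carrier : Type u
  [str : CompleteBooleanAlgebra carrier]
  ll : carrier → carrier → Prop
  isMVD : IsMVD ll

attribute [instance] IKA.str

namespace IKA

/-- Complete Boolean homomorphisms satisfying the two compatibility conditions with `≪`. -/
@[ext]
structure Hom (A B : IKA.{u}) : Type u where
  toHom : CompleteLatticeHom A.carrier B.carrier
  map_local_ll : ∀ a b, (∀ c, A.ll c ⊤ → A.ll (c ⊓ a) (cᶜ ⊔ b)) →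
    ∀ d, B.ll d ⊤ → B.ll (d ⊓ toHom a) (dᶜ ⊔ toHom b)
  lowerAdjoint_ll_top : ∀ b, B.ll b ⊤ → A.ll (lowerAdjoint toHom b) ⊤

instance : Category.{u} IKA.{u} where
  Hom := Hom
  id A :=
    { toHom := CompleteLatticeHom.id A.carrier
      map_local_ll := fun _ _ h => h
      lowerAdjoint_ll_top := fun b hb => by rwa [lowerAdjoint_id] }
  comp f g :=
    { toHom := g.toHom.comp f.toHom
      map_local_ll := fun a b h => g.map_local_ll _ _ (f.map_local_ll a b h)
      lowerAdjoint_ll_top := fun b hb => by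
        rw [lowerAdjoint_comp]
        exact f.lowerAdjoint_ll_top _ (g.lowerAdjoint_ll_top b hb) }

end IKA

/-! ### The category of locally compact Hausdorff spaces and continuous skeletal maps -/

/-- A function is skeletal if the closure of the image of every non-empty open set has
non-empty interior. -/
def IsSkeletal {X Y : Type u} [TopologicalSpace X] [TopologicalSpace Y] (f : X → Y) : Prop :=
  ∀ U : Set X, IsOpen U → U.Nonempty → (interior (closure (f '' U))).Nonempty

theorem isSkeletal_id {X : Type u} [TopologicalSpace X] : IsSkeletal (id : X → X) := by
  intro U hU hne
  rw [Set.image_id]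
  exact hne.mono (interior_maximal subset_closure hU)

theorem IsSkeletal.comp {X Y Z : Type u} [TopologicalSpace X] [TopologicalSpace Y]
    [TopologicalSpace Z] {g : Y → Z} {f : X → Y} (hg : IsSkeletal g) (hgc : Continuous g)
    (hf : IsSkeletal f) : IsSkeletal (g ∘ f) := by
  intro U hU hne
  refine (hg _ isOpen_interior (hf U hU hne)).mono (interior_mono ?_)
  refine closure_minimal ?_ isClosed_closure
  rw [Set.image_comp]
  exact (Set.image_mono interior_subset).trans (image_closure_subset_closure_image hgc)

/-- Locally compact Hausdorff spaces. -/
structure SKLC : Type (u + 1) where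
  carrier : Type u
  [top : TopologicalSpace carrier]
  [locallyCompact : LocallyCompactSpace carrier]
  [hausdorff : T2Space carrier]

attribute [instance] SKLC.top SKLC.locallyCompact SKLC.hausdorff

namespace SKLC

/-- Continuous skeletal maps. -/
@[ext]
structure Hom (X Y : SKLC.{u}) : Type u where
  toMap : C(X.carrier, Y.carrier)
  skeletal : IsSkeletal toMap

instance : Category.{u} SKLC.{u} where
  Hom := Hom
  id X := { toMap := ContinuousMap.id X.carrier, skeletal := isSkeletal_id }
  comp f g :=
    { toMap := g.toMap.comp f.toMap
      skeletal := g.skeletal.comp g.toMap.continuous f.skeletal }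

end SKLC

end RegionBased

/-! From a local contact algebra, let `a ≪ b` mean that `a` is bounded and `a ≪_ρ b`; boundedness
then becomes `a ≪ ⊤`. Conversely, the whole of `ρ` is recovered from its bounded part: `a ρ b` iff
`c ⊓ a ≪ cᶜ ⊔ bᶜ` fails for some `c ≪ ⊤`. The two passages are mutually inverse
(`contactOfLL_boundedLL`, by (BC2), and `boundedLL_contactOfLL`, by interpolation) and turn (L1),
(L2) into (S1), (S2). Keeping the underlying homomorphism therefore gives an isomorphism of
categories.

For the duality, a space goes to its regular open sets, with contact meaning that closures meet and
bounded meaning relatively compact. Skeletality is what makes regularized preimage preserve joins.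
For fullness, the value at `x` of the map realizing `φ` is a point in the closures of all `U` with
`x ∈ φ U`: (L2) supplies the compactness for its existence and (L1) gives continuity. Essential
surjectivity is proved on the MVD side: the points are proper round filters prime for `≪`,
completeness makes every regular open set basic, and `a ≪ b` says that the basic open set of `a` has
compact closure inside that of `b`. -/

namespace RegionBased

/-! ### Local contact algebras and MVD-algebras determine each other -/

section Algebra

variable {B : Type u} [BooleanAlgebra B]

namespace IsContact

variable {C : B → B → Prop}
theorem mono_right (h : IsContact C) {a b c : B} (hbc : b ≤ c) (hab : C a b) : C a c := by
  rw [← sup_eq_right.2 hbc]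
  exact (h.sup_iff _ _ _).2 (Or.inl hab)

theorem mono_left (h : IsContact C) {a b c : B} (hab : a ≤ b) (hac : C a c) : C b c :=
  h.symm _ _ (h.mono_right hab (h.symm _ _ hac))

theorem mono (h : IsContact C) {a b c d : B} (hab : a ≤ b) (hcd : c ≤ d) (hac : C a c) : C b d :=
  h.mono_right hcd (h.mono_left hab hac)

theorem nonTangential_mono (h : IsContact C) {a b c d : B} (hab : a ≤ b) (hbc : nonTangential C b c)
    (hcd : c ≤ d) : nonTangential C a d :=
  fun had => hbc (h.mono hab (compl_le_compl hcd) had)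

theorem le_of_nonTangential (h : IsContact C) {a b : B} (hab : nonTangential C a b) : a ≤ b := by
  by_contra hle
  have hne : a ⊓ bᶜ ≠ ⊥ := fun h0 => hle (by rwa [← sdiff_eq, sdiff_eq_bot_iff] at h0)
  exact hab (h.mono inf_le_left inf_le_right (h.refl_of_ne_bot _ hne))

end IsContact

/-- The relation "`a` is bounded and non-tangentially included in `b`". -/
def boundedLL (ρ : B → B → Prop) (bdd : Set B) (a b : B) : Prop :=
  a ∈ bdd ∧ nonTangential ρ a b

/-- The contact relation induced by an MVD relation. -/
def contactOfLL (ll : B → B → Prop) (a b : B) : Prop :=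
  ∃ c, ll c ⊤ ∧ ¬ ll (c ⊓ a) (cᶜ ⊔ bᶜ)

namespace IsLocalContact

variable {ρ : B → B → Prop} {bdd : Set B}

theorem boundedLL_top_iff (h : IsLocalContact ρ bdd) (a : B) :
    boundedLL ρ bdd a ⊤ ↔ a ∈ bdd := by
  refine ⟨And.left, fun ha => ⟨ha, fun hc => ?_⟩⟩
  exact (h.contact.ne_bot _ _ hc).2 compl_top

theorem isMVD_boundedLL (h : IsLocalContact ρ bdd) : IsMVD (boundedLL ρ bdd) where
  le_of_ll _ _ hab := h.contact.le_of_nonTangential hab.2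
  bot_ll_bot := ⟨h.bot_mem, fun hc => (h.contact.ne_bot _ _ hc).1 rfl⟩
  mono _ _ _ _ hab hbc hct :=
    ⟨h.mem_of_le _ _ hab hbc.1, h.contact.nonTangential_mono hab hbc.2 hct⟩
  sup_ll a b c ha hb := by
    refine ⟨h.sup_mem _ _ ha.1 hb.1, fun hc => ?_⟩
    rcases (h.contact.sup_iff _ _ _).1 (h.contact.symm _ _ hc) with hc | hc
    · exact ha.2 (h.contact.symm _ _ hc)
    · exact hb.2 (h.contact.symm _ _ hc)
  interpolate a c hac := by
    obtain ⟨b, hb, hab, hbc⟩ := h.interpolate a c hac.1 hac.2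
    exact ⟨b, ⟨hac.1, hab⟩, hb, hbc⟩
  exists_inside a ha := by
    obtain ⟨b, hb, hb0, hba⟩ := h.exists_bounded_inside a ha
    exact ⟨b, hb0, hb, hba⟩
  ll_inf a b c hb hc := by
    refine ⟨hb.1, fun hbc => ?_⟩
    rw [compl_inf, h.contact.sup_iff] at hbc
    exact hbc.elim hb.2 hc.2
  mvd a b ha hba := by
    refine ⟨ha.1, fun hab => hba.2 ?_⟩
    rw [compl_compl]
    exact h.contact.symm _ _ hab

theorem contactOfLL_boundedLL (h : IsLocalContact ρ bdd) :
    contactOfLL (boundedLL ρ bdd) = ρ := by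
  have key : ∀ b c : B, (cᶜ ⊔ bᶜ)ᶜ = c ⊓ b := fun b c => by simp
  funext a b
  refine propext ⟨?_, fun hab => ?_⟩
  · rintro ⟨c, hc, hn⟩
    rw [h.boundedLL_top_iff] at hc
    by_contra hab
    refine hn ⟨h.mem_of_le _ _ inf_le_left hc, fun hcc => hab ?_⟩
    rw [key] at hcc
    exact h.contact.mono inf_le_right inf_le_right hcc
  -- (BC2) is used once in each argument, so that the bounded element `c ⊔ d` already sees the
  -- contact on both sides.
  · obtain ⟨c, hc, hac⟩ := h.exists_bounded_contact a b hab
    obtain ⟨d, hd, hca⟩ := h.exists_bounded_contact _ _ (h.contact.symm _ _ hac)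
    refine ⟨c ⊔ d, (h.boundedLL_top_iff _).2 (h.sup_mem _ _ hc hd), fun hn => hn.2 ?_⟩
    rw [key]
    exact h.contact.mono (inf_le_inf_right _ le_sup_right) (inf_le_inf_right _ le_sup_left)
      (h.contact.symm _ _ hca)

/-- Local non-tangential inclusion with respect to bounded elements is non-tangential
inclusion. -/
theorem forall_boundedLL_iff (h : IsLocalContact ρ bdd) (a b : B) :
    (∀ c, boundedLL ρ bdd c ⊤ → boundedLL ρ bdd (c ⊓ a) (cᶜ ⊔ b)) ↔ nonTangential ρ a b := by
  have := congrFun (congrFun h.contactOfLL_boundedLL a) bᶜ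
  rw [nonTangential, ← this, contactOfLL, compl_compl]
  push Not
  rfl

end IsLocalContact

namespace IsMVD

variable {ll : B → B → Prop}

theorem ll_top (h : IsMVD ll) {a b : B} (hab : ll a b) : ll a ⊤ :=
  h.mono _ _ _ _ le_rfl hab le_top

theorem bot_ll (h : IsMVD ll) (a : B) : ll ⊥ a :=
  h.mono _ _ _ _ le_rfl h.bot_ll_bot bot_le

theorem nonTangential_contactOfLL (ll : B → B → Prop) (a b : B) :
    nonTangential (contactOfLL ll) a b ↔ ∀ c, ll c ⊤ → ll (c ⊓ a) (cᶜ ⊔ b) := by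
  simp [nonTangential, contactOfLL]

/-- The contrapositive of `a ≪ b`, cut down to a bounded element. -/
theorem inf_compl_ll_compl (h : IsMVD ll) {a b d : B} (hab : ll a b) (hd : ll d ⊤) :
    ll (d ⊓ bᶜ) aᶜ := by
  refine h.mvd _ _ (h.mono _ _ _ _ inf_le_left hd le_rfl) ?_
  rw [compl_compl, compl_inf, compl_compl]
  exact h.mono _ _ _ _ le_rfl hab le_sup_right

theorem boundedLL_contactOfLL (h : IsMVD ll) :
    boundedLL (contactOfLL ll) {a | ll a ⊤} = ll := by
  funext a c
  refine propext ⟨?_, fun hac => ⟨h.ll_top hac, ?_⟩⟩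
  · rintro ⟨ha, hac⟩
    rw [nonTangential_contactOfLL] at hac
    -- The test element is a `b` with `a ≪ b ≪ ⊤`: it gives `a ≪ bᶜ ⊔ c`, and meeting with `a ≪ b`
    -- removes the `bᶜ` part.
    obtain ⟨b, hab, hb⟩ := h.interpolate _ _ ha
    have h1 := hac b hb
    rw [inf_eq_right.2 (h.le_of_ll _ _ hab)] at h1
    refine h.mono _ _ _ _ le_rfl (h.ll_inf _ _ _ hab h1) ?_
    rw [inf_sup_left, inf_compl_eq_bot, bot_sup_eq]
    exact inf_le_right
  · rw [nonTangential_contactOfLL]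
    exact fun d _ => h.mono _ _ _ _ inf_le_right hac le_sup_right

theorem nonTangential_of_ll (h : IsMVD ll) {a b : B} (hab : ll a b) :
    nonTangential (contactOfLL ll) a b := by
  rw [← h.boundedLL_contactOfLL] at hab
  exact hab.2

theorem isContact_contactOfLL (h : IsMVD ll) : IsContact (contactOfLL ll) where
  refl_of_ne_bot a ha := by
    obtain ⟨b, hb0, hba⟩ := h.exists_inside a ha
    refine ⟨b, h.ll_top hba, fun hn => hb0 ?_⟩
    have hle := h.le_of_ll _ _ hba
    have h1 := h.le_of_ll _ _ hn
    rw [inf_eq_left.2 hle, ← compl_inf, inf_eq_left.2 hle] at h1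
    exact le_compl_self.1 h1
  ne_bot a b := by
    rintro ⟨c, hc, hn⟩
    constructor <;> rintro rfl <;> apply hn
    · rw [inf_bot_eq]
      exact h.bot_ll _
    · rw [compl_bot, sup_top_eq]
      exact h.mono _ _ _ _ inf_le_left hc le_rfl
  symm a b := by
    rintro ⟨c, hc, hn⟩
    refine ⟨c, hc, fun hm => hn ?_⟩
    -- Symmetry is axiom (MVD); cutting down by `c` makes its boundedness hypothesis available.
    refine h.mvd _ _ (h.mono _ _ _ _ inf_le_left hc le_rfl) ?_
    simpa using hm
  sup_iff a b c := by
    constructor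
    · rintro ⟨d, hd, hn⟩
      by_contra hcon
      simp only [contactOfLL, not_or, not_exists, not_and, not_not] at hcon
      refine hn ?_
      rw [compl_sup, sup_inf_left]
      exact h.ll_inf _ _ _ (hcon.1 d hd) (hcon.2 d hd)
    · rintro (⟨d, hd, hn⟩ | ⟨d, hd, hn⟩) <;>
      · refine ⟨d, hd, fun hm => hn (h.mono _ _ _ _ le_rfl hm (sup_le_sup_left ?_ _))⟩
        simp [compl_sup]

theorem isLocalContact_contactOfLL (h : IsMVD ll) :
    IsLocalContact (contactOfLL ll) {a | ll a ⊤} where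
  contact := h.isContact_contactOfLL
  bot_mem := h.bot_ll _
  mem_of_le a b hab hb := h.mono _ _ _ _ hab hb le_rfl
  sup_mem a b ha hb := h.sup_ll _ _ _ ha hb
  interpolate a c ha hac := by
    have hll : ll a c := by
      rw [← h.boundedLL_contactOfLL]
      exact ⟨ha, hac⟩
    obtain ⟨b, hab, hbc⟩ := h.interpolate _ _ hll
    exact ⟨b, h.ll_top hbc, h.nonTangential_of_ll hab, h.nonTangential_of_ll hbc⟩
  exists_bounded_contact a b := by
    rintro ⟨c, hc, hn⟩
    refine ⟨c, hc, c, hc, ?_⟩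
    rwa [compl_inf, ← sup_assoc, sup_idem]
  exists_bounded_inside a ha := by
    obtain ⟨b, hb0, hba⟩ := h.exists_inside a ha
    exact ⟨b, h.ll_top hba, hb0, h.nonTangential_of_ll hba⟩

end IsMVD

end Algebra

/-! ### The isomorphism between `SKAL` and `IKA` -/

/-- A round trip returns the same algebra with relations that are only propositionally equal, so
morphisms must be compared by `≍`; with the relations as variables, `subst` applies. -/
theorem SKAL.hom_heq {A B : Type u} [CompleteBooleanAlgebra A] [CompleteBooleanAlgebra B]
    {r r' : A → A → Prop} {s s' : Set A} {hA : IsLocalContact r s} {hA' : IsLocalContact r' s'}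
    {t t' : B → B → Prop} {v v' : Set B} {hB : IsLocalContact t v} {hB' : IsLocalContact t' v'}
    (hr : r = r') (hs : s = s') (ht : t = t') (hv : v = v')
    (f : SKAL.Hom ⟨A, r, s, hA⟩ ⟨B, t, v, hB⟩) (g : SKAL.Hom ⟨A, r', s', hA'⟩ ⟨B, t', v', hB'⟩)
    (hfg : f.toHom = g.toHom) : f ≍ g := by
  subst hr hs ht hv
  exact heq_of_eq (SKAL.Hom.ext hfg)

theorem IKA.hom_heq {A B : Type u} [CompleteBooleanAlgebra A] [CompleteBooleanAlgebra B]
    {r r' : A → A → Prop} {hA : IsMVD r} {hA' : IsMVD r'}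
    {t t' : B → B → Prop} {hB : IsMVD t} {hB' : IsMVD t'}
    (hr : r = r') (ht : t = t')
    (f : IKA.Hom ⟨A, r, hA⟩ ⟨B, t, hB⟩) (g : IKA.Hom ⟨A, r', hA'⟩ ⟨B, t', hB'⟩)
    (hfg : f.toHom = g.toHom) : f ≍ g := by
  subst hr ht
  exact heq_of_eq (IKA.Hom.ext hfg)

/-- The functor sending a complete local contact algebra to its MVD-algebra. -/
def skalToIKA : SKAL.{u} ⥤ IKA.{u} where
  obj A := ⟨A.carrier, boundedLL A.rel A.bdd, A.isLocalContact.isMVD_boundedLL⟩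
  map {A B} f :=
    { toHom := f.toHom
      map_local_ll := fun a b hab => by
        rw [A.isLocalContact.forall_boundedLL_iff] at hab
        rw [B.isLocalContact.forall_boundedLL_iff]
        intro hn
        rw [← map_compl'] at hn
        exact hab (f.contact_of_map _ _ hn)
      lowerAdjoint_ll_top := fun b hb =>
        (A.isLocalContact.boundedLL_top_iff _).2
          (f.lowerAdjoint_mem b ((B.isLocalContact.boundedLL_top_iff _).1 hb)) }

/-- The functor sending a complete MVD-algebra to its local contact algebra. -/
def ikaToSKAL : IKA.{u} ⥤ SKAL.{u} where
  obj A := ⟨A.carrier, contactOfLL A.ll, {a | A.ll a ⊤}, A.isMVD.isLocalContact_contactOfLL⟩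
  map {A B} f :=
    { toHom := f.toHom
      contact_of_map := fun a b => by
        contrapose
        intro hab
        have h := f.map_local_ll a bᶜ
        rw [← IsMVD.nonTangential_contactOfLL, ← IsMVD.nonTangential_contactOfLL,
          nonTangential, nonTangential, map_compl', compl_compl, compl_compl] at h
        exact h hab
      lowerAdjoint_mem := f.lowerAdjoint_ll_top }

theorem skalToIKA_comp_ikaToSKAL : skalToIKA.{u} ⋙ ikaToSKAL = 𝟭 _ := by
  have hb : ∀ A : SKAL.{u}, {a | boundedLL A.rel A.bdd a ⊤} = A.bdd := fun A =>
    Set.ext fun a => A.isLocalContact.boundedLL_top_iff a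
  have hr : ∀ A : SKAL.{u}, contactOfLL (boundedLL A.rel A.bdd) = A.rel := fun A =>
    A.isLocalContact.contactOfLL_boundedLL
  refine CategoryTheory.Functor.hext (fun A => ?_) (fun A B f => ?_)
  · change SKAL.mk A.carrier _ _ _ = A
    congr
    · exact hr A
    · exact hb A
  · exact SKAL.hom_heq (hr A) (hb A) (hr B) (hb B) _ f rfl

theorem ikaToSKAL_comp_skalToIKA : ikaToSKAL.{u} ⋙ skalToIKA = 𝟭 _ := by
  refine CategoryTheory.Functor.hext (fun A => ?_) (fun A B f => ?_)
  · change IKA.mk A.carrier _ _ = A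
    congr
    exact A.isMVD.boundedLL_contactOfLL
  · exact IKA.hom_heq A.isMVD.boundedLL_contactOfLL B.isMVD.boundedLL_contactOfLL _ f rfl

instance : skalToIKA.{u}.IsEquivalence :=
  (CategoryTheory.Equivalence.mk skalToIKA ikaToSKAL (eqToIso skalToIKA_comp_ikaToSKAL.symm)
    (eqToIso ikaToSKAL_comp_skalToIKA)).isEquivalence_functor

/-! ### The complete Boolean algebra of regular open sets -/

section RegularOpen

open TopologicalSpace Heyting

/-- Regular open subsets of a topological space. -/
def RegularOpen (X : Type u) [TopologicalSpace X] : Type u :=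
  Regular (Opens X)

namespace RegularOpen

variable {X : Type u} [TopologicalSpace X]

/-- The Boolean structure is that of the regular elements of the Heyting algebra of opens; joins are
regularized unions, and infima are obtained as joins of lower bounds. -/
instance : CompleteBooleanAlgebra (RegularOpen X) where
  __ := (inferInstance : BooleanAlgebra (Regular (Opens X)))
  sSup s := Regular.toRegular (sSup (Regular.val '' s))
  isLUB_sSup s := by
    refine ⟨fun a ha => ?_, fun b hb => ?_⟩
    · exact (Regular.gi.le_l_u a).trans
        (Regular.toRegular.monotone (le_sSup (Set.mem_image_of_mem _ ha)))
    · refine Regular.gi.gc.l_le (sSup_le ?_)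
      rintro _ ⟨a, ha, rfl⟩
      exact hb ha
  sInf s := Regular.toRegular (sSup (Regular.val '' lowerBounds s))
  isGLB_sInf s := by
    refine ⟨fun a ha => ?_, fun b hb => ?_⟩
    · refine Regular.gi.gc.l_le (sSup_le ?_)
      rintro _ ⟨c, hc, rfl⟩
      exact hc ha
    · exact (Regular.gi.le_l_u b).trans
        (Regular.toRegular.monotone (le_sSup (Set.mem_image_of_mem _ hb)))

/-- The underlying set of a regular open set. -/
def toSet (U : RegularOpen X) : Set X :=
  (Regular.val U : Opens X)

theorem isOpen (U : RegularOpen X) : IsOpen U.toSet :=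
  (Regular.val U).isOpen

theorem le_iff {U V : RegularOpen X} : U ≤ V ↔ U.toSet ⊆ V.toSet :=
  Iff.rfl

theorem toSet_injective : Function.Injective (toSet : RegularOpen X → Set X) :=
  fun _ _ h => le_antisymm (le_iff.2 h.le) (le_iff.2 h.ge)

@[simp]
theorem toSet_bot : (⊥ : RegularOpen X).toSet = ∅ :=
  rfl

@[simp]
theorem toSet_top : (⊤ : RegularOpen X).toSet = Set.univ :=
  rfl

theorem toSet_inf (U V : RegularOpen X) : (U ⊓ V).toSet = U.toSet ∩ V.toSet :=
  rfl

theorem coe_opens_compl (U : Opens X) : ((Uᶜ : Opens X) : Set X) = (closure (U : Set X))ᶜ := by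
  rw [Opens.coe_compl_eq_interior_compl, interior_compl]

theorem toSet_compl (U : RegularOpen X) : Uᶜ.toSet = (closure U.toSet)ᶜ :=
  coe_opens_compl (Regular.val U)

theorem coe_opens_compl_compl (U : Opens X) :
    ((Uᶜᶜ : Opens X) : Set X) = interior (closure (U : Set X)) := by
  rw [coe_opens_compl, coe_opens_compl, closure_compl, compl_compl]

theorem closure_toSet_compl (U : RegularOpen X) : closure Uᶜ.toSet = U.toSetᶜ := by
  have h := toSet_compl Uᶜ
  rw [compl_compl] at h
  rw [h, compl_compl]

theorem interior_closure_toSet (U : RegularOpen X) : interior (closure U.toSet) = U.toSet := by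
  have h := closure_toSet_compl U
  rw [toSet_compl, closure_compl] at h
  exact compl_injective h

theorem ne_bot_iff {U : RegularOpen X} : U ≠ ⊥ ↔ U.toSet.Nonempty := by
  rw [Set.nonempty_iff_ne_empty, ← toSet_bot, toSet_injective.ne_iff]

/-- The interior of the closure of a set, as a regular open set. -/
def ofSet (s : Set X) : RegularOpen X :=
  ⟨⟨interior (closure s), isOpen_interior⟩, by
    apply SetLike.coe_injective
    rw [coe_opens_compl_compl]
    exact interior_closure_idem⟩

theorem toSet_ofSet (s : Set X) : (ofSet s).toSet = interior (closure s) :=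
  rfl

theorem subset_ofSet {s : Set X} (hs : IsOpen s) : s ⊆ (ofSet s).toSet :=
  interior_maximal subset_closure hs

theorem ofSet_le_iff {s : Set X} (hs : IsOpen s) {U : RegularOpen X} :
    ofSet s ≤ U ↔ s ⊆ U.toSet := by
  refine ⟨(subset_ofSet hs).trans, fun h => ?_⟩
  rw [le_iff, ← U.interior_closure_toSet]
  exact interior_mono (closure_mono h)

/-- An open set meets `closure t` only inside the closure of its intersection with `t`; this is
applied to `interior (closure t)` against `s`, then to `s` against `t`, so `t` need not be open. -/
theorem interior_closure_inter {s t : Set X} (hs : IsOpen s) :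
    interior (closure (s ∩ t)) = interior (closure s) ∩ interior (closure t) := by
  rw [← interior_inter]
  refine (interior_mono (Set.subset_inter (closure_mono Set.inter_subset_left)
    (closure_mono Set.inter_subset_right))).antisymm (interior_maximal ?_ isOpen_interior)
  rw [interior_inter, Set.inter_comm]
  refine (Set.inter_subset_inter_right _ interior_subset).trans
    (isOpen_interior.inter_closure.trans (closure_minimal ?_ isClosed_closure))
  rw [Set.inter_comm]
  exact (Set.inter_subset_inter_right _ interior_subset).trans hs.inter_closure

theorem ofSet_toSet (U : RegularOpen X) : ofSet U.toSet = U :=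
  toSet_injective U.interior_closure_toSet

theorem closure_toSet_ofSet {s : Set X} (hs : IsOpen s) :
    closure (ofSet s).toSet = closure s :=
  (closure_minimal interior_subset isClosed_closure).antisymm (closure_mono (subset_ofSet hs))

theorem isLUB_of_subset_closure {S : Set (RegularOpen X)} {U : RegularOpen X}
    (hle : ∀ V ∈ S, V ≤ U) (hU : U.toSet ⊆ closure (⋃ V ∈ S, V.toSet)) : IsLUB S U := by
  refine ⟨hle, fun V hV => ?_⟩
  have hsub : (⋃ V ∈ S, V.toSet) ⊆ V.toSet := Set.iUnion₂_subset fun W hW => le_iff.1 (hV hW)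
  rw [le_iff, ← V.interior_closure_toSet]
  exact interior_maximal (hU.trans (closure_mono hsub)) U.isOpen

theorem toSet_sSup (S : Set (RegularOpen X)) :
    (sSup S).toSet = interior (closure (⋃ V ∈ S, V.toSet)) := by
  have hopen : IsOpen (⋃ V ∈ S, V.toSet) := isOpen_biUnion fun V _ => V.isOpen
  have h : IsLUB S (ofSet (⋃ V ∈ S, V.toSet)) := by
    refine isLUB_of_subset_closure (fun V hV => ?_) interior_subset
    exact (Set.subset_biUnion_of_mem hV).trans (subset_ofSet hopen)
  rw [h.sSup_eq]
  rfl

end RegularOpen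

end RegularOpen

/-- A map between complete Boolean algebras preserving joins, binary meets and the top
is a complete homomorphism. -/
def completeLatticeHomOfSSup {A B : Type u} [CompleteBooleanAlgebra A] [CompleteBooleanAlgebra B]
    (φ : A → B) (hsup : ∀ S : Set A, φ (sSup S) = sSup (φ '' S))
    (hinf : ∀ a b, φ (a ⊓ b) = φ a ⊓ φ b) (htop : φ ⊤ = ⊤) : CompleteLatticeHom A B :=
  have hbot : φ ⊥ = ⊥ := by simpa using hsup ∅
  have hsup2 : ∀ a b, φ (a ⊔ b) = φ a ⊔ φ b := fun a b => by
    simpa [Set.image_pair, sSup_pair] using hsup {a, b}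
  have hcompl : ∀ a, φ aᶜ = (φ a)ᶜ := fun a => by
    refine eq_compl_iff_isCompl.2 (IsCompl.of_eq ?_ ?_)
    · rw [← hinf, compl_inf_eq_bot, hbot]
    · rw [← hsup2, compl_sup_eq_top, htop]
  { toFun := φ
    map_sSup' := hsup
    map_sInf' := fun S => by
      rw [← compl_inj_iff, ← hcompl, compl_sInf', hsup, compl_sInf', Set.image_image,
        Set.image_image]
      simp only [hcompl] }

/-! ### The local contact algebra of a locally compact Hausdorff space -/

namespace RegularOpen

section LocallyCompact

variable {X : Type u} [TopologicalSpace X]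

/-- Two regular open sets are in contact when their closures meet. -/
def contact (U V : RegularOpen X) : Prop :=
  (closure U.toSet ∩ closure V.toSet).Nonempty

/-- The relatively compact regular open sets. -/
def relCompact (X : Type u) [TopologicalSpace X] : Set (RegularOpen X) :=
  {U | IsCompact (closure U.toSet)}

theorem nonTangential_contact_iff {U V : RegularOpen X} :
    nonTangential contact U V ↔ closure U.toSet ⊆ V.toSet := by
  rw [nonTangential, contact, closure_toSet_compl, Set.not_nonempty_iff_eq_empty,
    ← Set.sdiff_eq, Set.sdiff_eq_empty]

theorem relCompact_of_subset [T2Space X] {U : RegularOpen X} {K : Set X} (hK : IsCompact K)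
    (h : U.toSet ⊆ K) : U ∈ relCompact X :=
  hK.closure_of_subset h

theorem isContact_contact : IsContact (contact (X := X)) where
  refl_of_ne_bot U hU := by
    rw [contact, Set.inter_self]
    exact (ne_bot_iff.1 hU).closure
  ne_bot U V h := by
    constructor <;> rintro rfl <;> simp [contact] at h
  symm U V h := by rwa [contact, Set.inter_comm] at h
  sup_iff U V W := by
    have hcl : closure (V ⊔ W).toSet = closure V.toSet ∪ closure W.toSet := by
      rw [← closure_union, ← closure_toSet_ofSet (V.isOpen.union W.isOpen)]
      congr 2
      refine le_antisymm (sup_le ?_ ?_) ?_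
      · exact Set.subset_union_left.trans (subset_ofSet (V.isOpen.union W.isOpen))
      · exact Set.subset_union_right.trans (subset_ofSet (V.isOpen.union W.isOpen))
      · rw [ofSet_le_iff (V.isOpen.union W.isOpen)]
        exact Set.union_subset (le_iff.1 le_sup_left) (le_iff.1 le_sup_right)
    rw [contact, hcl, Set.inter_union_distrib_left, Set.union_nonempty]
    rfl

variable [LocallyCompactSpace X] [T2Space X]

theorem exists_relCompact_between {K s : Set X} (hK : IsCompact K) (hs : IsOpen s)
    (hKs : K ⊆ s) : ∃ U ∈ relCompact X, K ⊆ U.toSet ∧ closure U.toSet ⊆ s := by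
  obtain ⟨L, hL, hKL, hLs⟩ := exists_compact_between hK hs hKs
  have hcl : closure (ofSet (interior L)).toSet ⊆ L := by
    rw [closure_toSet_ofSet isOpen_interior]
    exact closure_minimal interior_subset hL.isClosed
  exact ⟨ofSet (interior L), hL.of_isClosed_subset isClosed_closure hcl,
    hKL.trans (subset_ofSet isOpen_interior), hcl.trans hLs⟩

theorem exists_relCompact_mem {x : X} {s : Set X} (hs : IsOpen s) (hx : x ∈ s) :
    ∃ U ∈ relCompact X, x ∈ U.toSet ∧ closure U.toSet ⊆ s := by
  obtain ⟨U, hU, hxU, hUs⟩ :=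
    exists_relCompact_between isCompact_singleton hs (Set.singleton_subset_iff.2 hx)
  exact ⟨U, hU, hxU rfl, hUs⟩

theorem isLocalContact : IsLocalContact (contact (X := X)) (relCompact X) where
  contact := isContact_contact
  bot_mem := by simp [relCompact]
  mem_of_le U V hUV hV := relCompact_of_subset hV ((le_iff.1 hUV).trans subset_closure)
  sup_mem U V hU hV := by
    have hUV := IsCompact.union hU hV
    refine hUV.of_isClosed_subset isClosed_closure ?_
    rw [← closure_union]
    refine closure_minimal ?_ isClosed_closure
    refine (le_iff.1 (sup_le ?_ ?_ : U ⊔ V ≤ ofSet (U.toSet ∪ V.toSet))).trans interior_subset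
    · exact Set.subset_union_left.trans (subset_ofSet (U.isOpen.union V.isOpen))
    · exact Set.subset_union_right.trans (subset_ofSet (U.isOpen.union V.isOpen))
  interpolate U W hU hUW := by
    rw [nonTangential_contact_iff] at hUW
    obtain ⟨V, hV, hUV, hVW⟩ := exists_relCompact_between hU W.isOpen hUW
    exact ⟨V, hV, nonTangential_contact_iff.2 hUV, nonTangential_contact_iff.2 hVW⟩
  exists_bounded_contact U V := by
    rintro ⟨x, hxU, hxV⟩
    obtain ⟨W, hW, hxW, -⟩ := exists_relCompact_mem isOpen_univ (Set.mem_univ x)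
    refine ⟨W, hW, x, hxU, ?_⟩
    rw [toSet_inf]
    exact W.isOpen.inter_closure ⟨hxW, hxV⟩
  exists_bounded_inside U hU := by
    obtain ⟨x, hx⟩ := ne_bot_iff.1 hU
    obtain ⟨V, hV, hxV, hVU⟩ := exists_relCompact_mem U.isOpen hx
    exact ⟨V, hV, ne_bot_iff.2 ⟨x, hxV⟩, nonTangential_contact_iff.2 hVU⟩

end LocallyCompact

/-! ### The homomorphism induced by a continuous skeletal map -/

section Preimage

variable {X Y : Type u} [TopologicalSpace X] [TopologicalSpace Y]

/-- Otherwise a non-empty open set would be mapped into `closure V ∩ Vᶜ`, which is closed with empty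
interior, against skeletality. Preservation of joins and functoriality rest on this. -/
theorem _root_.RegionBased.IsSkeletal.preimage_interior_closure_subset {f : X → Y}
    (hs : IsSkeletal f) (hf : Continuous f) {V : Set Y} (hV : IsOpen V) :
    f ⁻¹' interior (closure V) ⊆ closure (f ⁻¹' V) := by
  by_contra hn
  obtain ⟨x, hx, hxV⟩ := Set.not_subset.1 hn
  have hopen : IsOpen (f ⁻¹' interior (closure V) ∩ (closure (f ⁻¹' V))ᶜ) :=
    (isOpen_interior.preimage hf).inter isClosed_closure.isOpen_compl
  obtain ⟨y, hy⟩ := hs _ hopen ⟨x, hx, hxV⟩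
  have hsub : closure (f '' (f ⁻¹' interior (closure V) ∩ (closure (f ⁻¹' V))ᶜ)) ⊆
      closure V ∩ Vᶜ := by
    refine closure_minimal ?_ (isClosed_closure.inter hV.isClosed_compl)
    rintro _ ⟨z, ⟨hz, hzV⟩, rfl⟩
    exact ⟨interior_subset hz, fun hfz => hzV (subset_closure hfz)⟩
  have hyV := (hsub (interior_subset hy)).1
  obtain ⟨z, hz, hzV⟩ := mem_closure_iff.1 hyV _ isOpen_interior hy
  exact (hsub (interior_subset hz)).2 hzV

/-- The regular open hull of the preimage, as a complete homomorphism. -/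
def preimageHom (f : X → Y) (hf : Continuous f) (hs : IsSkeletal f) :
    CompleteLatticeHom (RegularOpen Y) (RegularOpen X) :=
  completeLatticeHomOfSSup (fun U => ofSet (f ⁻¹' U.toSet))
    (fun S => by
      refine (IsLUB.sSup_eq (isLUB_of_subset_closure ?_ ?_)).symm
      · rintro _ ⟨V, hV, rfl⟩
        refine le_iff.2 (interior_mono (closure_mono (Set.preimage_mono ?_)))
        exact le_iff.1 (le_sSup hV)
      · refine interior_subset.trans (closure_minimal ?_ isClosed_closure)
        rw [toSet_sSup]
        refine (hs.preimage_interior_closure_subset hf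
          (isOpen_biUnion fun V _ => V.isOpen)).trans (closure_mono ?_)
        rw [Set.preimage_iUnion₂]
        refine Set.iUnion₂_subset fun V hV => ?_
        exact (subset_ofSet (V.isOpen.preimage hf)).trans
          (Set.subset_biUnion_of_mem (u := toSet) (Set.mem_image_of_mem _ hV)))
    (fun U V => by
      apply toSet_injective
      rw [toSet_inf, toSet_ofSet, toSet_inf, Set.preimage_inter,
        interior_closure_inter (U.isOpen.preimage hf)]
      rfl)
    (by
      apply toSet_injective
      simp [toSet_ofSet])

theorem preimageHom_apply (f : X → Y) (hf : Continuous f) (hs : IsSkeletal f)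
    (U : RegularOpen Y) : preimageHom f hf hs U = ofSet (f ⁻¹' U.toSet) :=
  rfl

theorem preimage_subset_preimageHom (f : X → Y) (hf : Continuous f) (hs : IsSkeletal f)
    (U : RegularOpen Y) : f ⁻¹' U.toSet ⊆ (preimageHom f hf hs U).toSet :=
  subset_ofSet (U.isOpen.preimage hf)

theorem closure_preimageHom_subset (f : X → Y) (hf : Continuous f) (hs : IsSkeletal f)
    (U : RegularOpen Y) : closure (preimageHom f hf hs U).toSet ⊆ f ⁻¹' closure U.toSet := by
  rw [preimageHom_apply, closure_toSet_ofSet (U.isOpen.preimage hf)]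
  exact hf.closure_preimage_subset _

theorem contact_of_preimageHom (f : X → Y) (hf : Continuous f) (hs : IsSkeletal f)
    {U V : RegularOpen Y} (h : contact (preimageHom f hf hs U) (preimageHom f hf hs V)) :
    contact U V := by
  obtain ⟨x, hxU, hxV⟩ := h
  exact ⟨f x, closure_preimageHom_subset f hf hs U hxU, closure_preimageHom_subset f hf hs V hxV⟩

theorem preimageHom_id : preimageHom (id : X → X) continuous_id isSkeletal_id =
    CompleteLatticeHom.id _ := by
  ext1 U
  exact ofSet_toSet U

theorem preimageHom_comp {Z : Type u} [TopologicalSpace Z] {g : Y → Z} {f : X → Y}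
    (hg : Continuous g) (hf : Continuous f) (hgs : IsSkeletal g) (hfs : IsSkeletal f) :
    preimageHom (g ∘ f) (hg.comp hf) (hgs.comp hg hfs) =
      (preimageHom f hf hfs).comp (preimageHom g hg hgs) := by
  ext1 U
  refine le_antisymm ?_ ?_
  · rw [preimageHom_apply, ofSet_le_iff (U.isOpen.preimage (hg.comp hf))]
    exact (Set.preimage_mono (preimage_subset_preimageHom g hg hgs U)).trans
      (preimage_subset_preimageHom f hf hfs _)
  · refine (ofSet_le_iff ((isOpen (preimageHom g hg hgs U)).preimage hf)).2 ?_
    exact interior_maximal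
      (hfs.preimage_interior_closure_subset hf (U.isOpen.preimage hg))
      ((isOpen (preimageHom g hg hgs U)).preimage hf)

/-- The image of `closure W` is compact, hence lies in a relatively compact `U`, and adjunction puts
the lower adjoint of `W` below `U`. -/
theorem lowerAdjoint_preimageHom_mem [LocallyCompactSpace Y] [T2Space Y] (f : X → Y)
    (hf : Continuous f) (hs : IsSkeletal f) {W : RegularOpen X} (hW : W ∈ relCompact X) :
    lowerAdjoint (preimageHom f hf hs) W ∈ relCompact Y := by
  obtain ⟨U, hU, hWU, -⟩ :=
    exists_relCompact_between (hW.image hf) isOpen_univ (Set.subset_univ _)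
  have hle : W ≤ preimageHom f hf hs U := by
    refine Set.Subset.trans ?_ (preimage_subset_preimageHom f hf hs U)
    exact fun x hx => hWU ⟨x, subset_closure hx, rfl⟩
  exact isLocalContact.mem_of_le _ _ ((lowerAdjoint_gc _ _ _).2 hle) hU

end Preimage

end RegularOpen

/-- The contravariant functor of regular open sets. -/
def regularOpenFunctor : SKLC.{u}ᵒᵖ ⥤ SKAL.{u} where
  obj X := ⟨RegularOpen X.unop.carrier, RegularOpen.contact, RegularOpen.relCompact _,
    RegularOpen.isLocalContact⟩
  map f :=
    { toHom := RegularOpen.preimageHom f.unop.toMap f.unop.toMap.continuous f.unop.skeletal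
      contact_of_map := fun _ _ h => RegularOpen.contact_of_preimageHom _ _ _ h
      lowerAdjoint_mem := fun _ hW => RegularOpen.lowerAdjoint_preimageHom_mem _ _ _ hW }
  map_id _ := SKAL.Hom.ext RegularOpen.preimageHom_id
  map_comp f g := SKAL.Hom.ext (RegularOpen.preimageHom_comp
    f.unop.toMap.continuous g.unop.toMap.continuous f.unop.skeletal g.unop.skeletal)

/-! ### The functor of regular open sets is fully faithful -/

namespace RegularOpen

variable {X Y : Type u} [TopologicalSpace X] [TopologicalSpace Y]

theorem mem_compl_of_notMem_closure {U : RegularOpen X} {x : X} (hx : x ∉ closure U.toSet) :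
    x ∈ Uᶜ.toSet := by
  rwa [toSet_compl]

theorem notMem_closure_compl {U : RegularOpen X} {x : X} (hx : x ∈ U.toSet) :
    x ∉ closure Uᶜ.toSet := by
  rw [closure_toSet_compl]
  exact fun h => h hx

theorem eq_of_preimageHom_eq [LocallyCompactSpace Y] [T2Space Y] {f g : X → Y}
    (hf : Continuous f) (hg : Continuous g) (hfs : IsSkeletal f) (hgs : IsSkeletal g)
    (h : preimageHom f hf hfs = preimageHom g hg hgs) : f = g := by
  funext x
  by_contra hne
  obtain ⟨U, -, hxU, hUg⟩ := exists_relCompact_mem isOpen_compl_singleton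
    (Set.mem_compl_singleton_iff.2 hne)
  have h1 : x ∈ (preimageHom f hf hfs U).toSet := preimage_subset_preimageHom f hf hfs U hxU
  rw [h] at h1
  exact hUg (closure_preimageHom_subset g hg hgs U (subset_closure h1)) rfl

/-! ### Reconstructing a continuous skeletal map from a complete homomorphism -/

section Realize

variable (φ : CompleteLatticeHom (RegularOpen Y) (RegularOpen X))

/-- `y` realizes `φ` at `x` if it lies in the closure of every `U` with `x ∈ φ U`. -/
def Realizes (x : X) (y : Y) : Prop :=
  ∀ U : RegularOpen Y, x ∈ (φ U).toSet → y ∈ closure U.toSet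

variable {φ}

theorem Realizes.mem_closure {x : X} {y : Y} (h : Realizes φ x y) {U : RegularOpen Y}
    (hy : y ∈ U.toSet) : x ∈ closure (φ U).toSet := by
  by_contra hx
  have hx' := mem_compl_of_notMem_closure hx
  rw [← map_compl'] at hx'
  exact notMem_closure_compl hy (h _ hx')

/-- The `U` with `x ∈ φ U` form a filter. Intersecting with `U₀`, whose closure is compact by (L2),
turns their closures into a directed family of non-empty compact sets. -/
theorem exists_realizes [LocallyCompactSpace X] [T2Space X]
    (hb : ∀ W ∈ relCompact X, lowerAdjoint φ W ∈ relCompact Y) (x : X) :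
    ∃ y, Realizes φ x y := by
  obtain ⟨W, hW, hxW, -⟩ := exists_relCompact_mem isOpen_univ (Set.mem_univ x)
  let U₀ := lowerAdjoint φ W
  have hxU₀ : x ∈ (φ U₀).toSet := le_iff.1 ((lowerAdjoint_gc φ).le_u_l W) hxW
  have hcompact : IsCompact (closure U₀.toSet) := hb W hW
  have : Nonempty {U : RegularOpen Y // x ∈ (φ U).toSet} := ⟨⟨U₀, hxU₀⟩⟩
  have hne := IsCompact.nonempty_iInter_of_directed_nonempty_isCompact_isClosed
    (fun U : {U : RegularOpen Y // x ∈ (φ U).toSet} => closure (U₀ ⊓ U.1).toSet)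
    (fun U V => ?_) (fun U => ?_) (fun U => ?_) (fun U => isClosed_closure)
  · obtain ⟨y, hy⟩ := hne
    refine ⟨y, fun U hU => ?_⟩
    exact closure_mono (le_iff.1 inf_le_right) (Set.mem_iInter.1 hy ⟨U, hU⟩)
  · refine ⟨⟨U.1 ⊓ V.1, ?_⟩, ?_, ?_⟩
    · rw [map_inf, toSet_inf]
      exact ⟨U.2, V.2⟩
    · exact closure_mono (le_iff.1 (inf_le_inf_left _ inf_le_left))
    · exact closure_mono (le_iff.1 (inf_le_inf_left _ inf_le_right))
  · refine (ne_bot_iff.1 fun h0 => ?_).closure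
    have hx : x ∈ (φ (U₀ ⊓ U.1)).toSet := by
      rw [map_inf, toSet_inf]
      exact ⟨hxU₀, U.2⟩
    rw [h0, map_bot] at hx
    exact hx
  · exact hcompact.of_isClosed_subset isClosed_closure (closure_mono (le_iff.1 inf_le_left))

variable [LocallyCompactSpace Y] [T2Space Y]

/-- Shrinking `U` to a `V` around `y` with closure in `U`, (L1) gives `closure (φ V) ⊆ φ U`, which
absorbs the closure in `Realizes.mem_closure`. -/
theorem Realizes.mem (hc : ∀ U V, contact (φ U) (φ V) → contact U V) {x : X} {y : Y}
    (h : Realizes φ x y) {U : RegularOpen Y} (hy : y ∈ U.toSet) : x ∈ (φ U).toSet := by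
  obtain ⟨V, -, hyV, hVU⟩ := exists_relCompact_mem U.isOpen hy
  have hVU' : nonTangential contact (φ V) (φ U) := by
    rw [← nonTangential_contact_iff] at hVU
    intro hn
    rw [← map_compl'] at hn
    exact hVU (hc _ _ hn)
  exact nonTangential_contact_iff.1 hVU' (h.mem_closure hyV)

theorem continuous_of_realizes (hc : ∀ U V, contact (φ U) (φ V) → contact U V) {f : X → Y}
    (hf : ∀ x, Realizes φ x (f x)) : Continuous f := by
  refine continuous_iff_continuousAt.2 fun x => ?_
  intro s hs
  obtain ⟨t, hts, ht, hxt⟩ := mem_nhds_iff.1 hs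
  obtain ⟨U, -, hxU, hUt⟩ := exists_relCompact_mem ht hxt
  refine Filter.mem_map.2 (Filter.mem_of_superset
    ((φ U).isOpen.mem_nhds ((hf x).mem hc hxU)) fun x' hx' => ?_)
  exact hts (hUt (hf x' U hx'))

theorem isSkeletal_of_realizes [LocallyCompactSpace X] [T2Space X] {f : X → Y}
    (hf : ∀ x, Realizes φ x (f x)) : IsSkeletal f := by
  rintro s hs ⟨x, hx⟩
  obtain ⟨W, -, hxW, hWs⟩ := exists_relCompact_mem hs hx
  let U := lowerAdjoint φ W
  have hWU : W ≤ φ U := (lowerAdjoint_gc φ).le_u_l W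
  have hU : U.toSet.Nonempty := by
    refine ne_bot_iff.1 fun h0 => ?_
    rw [h0, map_bot] at hWU
    exact le_iff.1 hWU hxW
  -- Were part of `U` outside this closure, some non-empty `V` inside `U` would satisfy `W ≤ φ Vᶜ`;
  -- minimality of `U` then forces `U ≤ Vᶜ`.
  suffices hsub : U.toSet ⊆ closure (f '' W.toSet) from
    hU.mono (interior_maximal
      (hsub.trans (closure_mono (Set.image_mono (subset_closure.trans hWs)))) U.isOpen)
  intro y hy
  by_contra hyW
  obtain ⟨V, -, hyV, hVW⟩ := exists_relCompact_mem
    (U.isOpen.inter isClosed_closure.isOpen_compl) ⟨hy, hyW⟩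
  have hWV : W ≤ φ Vᶜ := by
    intro x hx
    rw [map_compl']
    refine mem_compl_of_notMem_closure fun hxV => ?_
    obtain ⟨z, hzV, hzW⟩ := (closure_inter_open_nonempty_iff W.isOpen).1 ⟨x, hxV, hx⟩
    exact (hVW (hf z V hzV)).2 (subset_closure ⟨z, hzW, rfl⟩)
  exact notMem_closure_compl hyV (subset_closure
    (le_iff.1 ((lowerAdjoint_gc φ W Vᶜ).2 hWV) hy))

theorem preimageHom_eq_of_realizes (hc : ∀ U V, contact (φ U) (φ V) → contact U V) {f : X → Y}
    (hf : ∀ x, Realizes φ x (f x)) (hfc : Continuous f) (hfs : IsSkeletal f) :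
    preimageHom f hfc hfs = φ := by
  have hle : ∀ U, preimageHom f hfc hfs U ≤ φ U := fun U =>
    (ofSet_le_iff (U.isOpen.preimage hfc)).2 fun x hx => (hf x).mem hc hx
  ext1 U
  refine le_antisymm (hle U) ?_
  rw [← compl_le_compl_iff_le, ← map_compl', ← map_compl']
  exact hle Uᶜ

end Realize

end RegularOpen

instance : regularOpenFunctor.{u}.Faithful where
  map_injective {X Y f g} h := by
    apply Quiver.Hom.unop_inj
    refine SKLC.Hom.ext (ContinuousMap.ext fun x => ?_)
    exact congrFun (RegularOpen.eq_of_preimageHom_eq f.unop.toMap.continuous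
      g.unop.toMap.continuous f.unop.skeletal g.unop.skeletal (congrArg SKAL.Hom.toHom h)) x

instance : regularOpenFunctor.{u}.Full where
  map_surjective {X Y} φ := by
    choose f hf using RegularOpen.exists_realizes φ.lowerAdjoint_mem
    have hfc := RegularOpen.continuous_of_realizes φ.contact_of_map hf
    have hfs := RegularOpen.isSkeletal_of_realizes hf
    let F : Y.unop ⟶ X.unop := SKLC.Hom.mk ⟨f, hfc⟩ hfs
    refine ⟨F.op, SKAL.Hom.ext ?_⟩
    exact RegularOpen.preimageHom_eq_of_realizes φ.contact_of_map hf hfc hfs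

/-! ### The space of points of an MVD-algebra -/

section Points

/-- A point of an MVD-algebra: a proper round filter that is prime with respect to `≪`. -/
@[ext]
structure Point {B : Type u} [BooleanAlgebra B] (ll : B → B → Prop) : Type u where
  sets : Set B
  top_mem : ⊤ ∈ sets
  bot_notMem : ⊥ ∉ sets
  mem_of_le : ∀ a b, a ∈ sets → a ≤ b → b ∈ sets
  inf_mem : ∀ a b, a ∈ sets → b ∈ sets → a ⊓ b ∈ sets
  round : ∀ b ∈ sets, ∃ a ∈ sets, ll a b
  prime : ∀ a b, ll a b → aᶜ ∈ sets ∨ b ∈ sets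

variable {B : Type u} [BooleanAlgebra B] {ll : B → B → Prop}

theorem IsMVD.ll_inf_inf (h : IsMVD ll) {a b c d : B} (hab : ll a b) (hcd : ll c d) :
    ll (a ⊓ c) (b ⊓ d) :=
  h.ll_inf _ _ _ (h.mono _ _ _ _ inf_le_left hab le_rfl) (h.mono _ _ _ _ inf_le_right hcd le_rfl)

/-- The elements non-tangentially containing a member of an ultrafilter form a point. -/
def IsMVD.pointOfUltrafilter (h : IsMVD ll) (u : Set B) (hbot : ⊥ ∉ u)
    (hbdd : ∃ a ∈ u, ll a ⊤) (hinf : ∀ a b, a ∈ u → b ∈ u → a ⊓ b ∈ u)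
    (hor : ∀ a, a ∈ u ∨ aᶜ ∈ u) : Point ll where
  sets := {b | ∃ a ∈ u, ll a b}
  top_mem := hbdd
  bot_notMem := by
    rintro ⟨a, ha, hab⟩
    exact hbot (le_bot_iff.1 (h.le_of_ll _ _ hab) ▸ ha)
  mem_of_le := by
    rintro b c ⟨a, ha, hab⟩ hbc
    exact ⟨a, ha, h.mono _ _ _ _ le_rfl hab hbc⟩
  inf_mem := by
    rintro b d ⟨a, ha, hab⟩ ⟨c, hc, hcd⟩
    exact ⟨a ⊓ c, hinf _ _ ha hc, h.ll_inf_inf hab hcd⟩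
  round := by
    rintro b ⟨a, ha, hab⟩
    obtain ⟨c, hac, hcb⟩ := h.interpolate _ _ hab
    exact ⟨c, ⟨a, ha, hac⟩, hcb⟩
  prime a b hab := by
    obtain ⟨c, hac, hcb⟩ := h.interpolate _ _ hab
    obtain ⟨d, hd, hdt⟩ := hbdd
    rcases hor c with hc | hc
    · exact Or.inr ⟨c, hc, hcb⟩
    -- `cᶜ` may be unbounded, so it is cut down by the bounded member `d` before contraposing.
    · exact Or.inl ⟨d ⊓ cᶜ, hinf _ _ hd hc, h.inf_compl_ll_compl hac hdt⟩

theorem IsMVD.exists_point (h : IsMVD ll) {a : B} (ha : a ≠ ⊥) : ∃ p : Point ll, a ∈ p.sets := by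
  obtain ⟨b, hb0, hba⟩ := h.exists_inside a ha
  -- The complement of a prime ideal avoiding `b` is an ultrafilter containing the bounded element
  -- `b`.
  obtain ⟨I, hI, hFI⟩ := DistribLattice.prime_ideal_of_disjoint_filter_ideal
    (F := Order.PFilter.principal b) (I := Order.Ideal.principal ⊥) (by
      rw [Set.disjoint_left]
      intro x hx hx0
      exact hb0 (le_bot_iff.1 ((Order.PFilter.mem_principal.1 hx).trans
        (Order.Ideal.mem_principal.1 hx0))))
  have hbI : b ∉ I := fun hb => Set.disjoint_left.1 hFI.2 (Order.PFilter.mem_principal.2 le_rfl) hb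
  refine ⟨h.pointOfUltrafilter {x | x ∉ I} (fun hn => hn I.bot_mem) ⟨b, hbI, h.ll_top hba⟩
    (fun x y hx hy hxy => (hI.mem_or_mem hxy).elim hx hy) (fun x => ?_), b, hbI, hba⟩
  by_contra! hcon
  simp only [Set.mem_ofPred_eq, not_not] at hcon
  refine hbI (I.lower le_top ?_)
  rw [← sup_compl_eq_top (x := x)]
  exact I.sup_mem hcon.1 hcon.2

/-- The basic open set of points containing `a`. -/
def basicOpen (ll : B → B → Prop) (a : B) : Set (Point ll) :=
  {p | a ∈ p.sets}

theorem basicOpen_top : basicOpen ll ⊤ = Set.univ :=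
  Set.eq_univ_of_forall fun p => p.top_mem

theorem basicOpen_bot : basicOpen ll ⊥ = ∅ :=
  Set.eq_empty_of_forall_notMem fun p => p.bot_notMem

theorem basicOpen_mono {a b : B} (hab : a ≤ b) : basicOpen ll a ⊆ basicOpen ll b :=
  fun p hp => p.mem_of_le _ _ hp hab

theorem basicOpen_inf (a b : B) : basicOpen ll (a ⊓ b) = basicOpen ll a ∩ basicOpen ll b :=
  (Set.subset_inter (basicOpen_mono inf_le_left) (basicOpen_mono inf_le_right)).antisymm
    fun p hp => p.inf_mem _ _ hp.1 hp.2

instance : TopologicalSpace (Point ll) :=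
  TopologicalSpace.generateFrom (Set.range (basicOpen ll))

theorem isTopologicalBasis_basicOpen :
    TopologicalSpace.IsTopologicalBasis (Set.range (basicOpen ll)) where
  exists_subset_inter := by
    rintro _ ⟨a, rfl⟩ _ ⟨b, rfl⟩ p hp
    exact ⟨_, ⟨a ⊓ b, rfl⟩, by rwa [basicOpen_inf], (basicOpen_inf a b).subset⟩
  sUnion_eq := Set.eq_univ_of_univ_subset
    (basicOpen_top (ll := ll) ▸ Set.subset_sUnion_of_mem ⟨⊤, rfl⟩)
  eq_generateFrom := rfl

theorem isOpen_basicOpen (a : B) : IsOpen (basicOpen ll a) :=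
  isTopologicalBasis_basicOpen.isOpen ⟨a, rfl⟩

theorem IsMVD.basicOpen_nonempty_iff (h : IsMVD ll) {a : B} :
    (basicOpen ll a).Nonempty ↔ a ≠ ⊥ := by
  refine ⟨?_, fun ha => h.exists_point ha⟩
  rintro hne rfl
  simp [basicOpen_bot] at hne

/-- Non-zero elements lie in some point, so a basic neighbourhood given by `b` misses that of `a`
only when `b ≤ aᶜ`. -/
theorem IsMVD.closure_basicOpen (h : IsMVD ll) (a : B) :
    closure (basicOpen ll a) = (basicOpen ll aᶜ)ᶜ := by
  refine (closure_minimal ?_ (isOpen_basicOpen _).isClosed_compl).antisymm fun p hp => ?_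
  · intro p hp hpc
    have := p.inf_mem _ _ hp hpc
    rw [inf_compl_eq_bot] at this
    exact p.bot_notMem this
  · rw [isTopologicalBasis_basicOpen.mem_closure_iff]
    rintro _ ⟨b, rfl⟩ hb
    rw [← basicOpen_inf, h.basicOpen_nonempty_iff]
    intro h0
    exact hp (p.mem_of_le _ _ hb (le_compl_iff_disjoint_right.2 (disjoint_iff.2 h0)))

theorem IsMVD.closure_basicOpen_subset (h : IsMVD ll) {a b : B} (hab : ll a b) :
    closure (basicOpen ll a) ⊆ basicOpen ll b := by
  rw [h.closure_basicOpen]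
  exact fun p hp => (p.prime a b hab).resolve_left hp

theorem IsMVD.basicOpen_subset_iff (h : IsMVD ll) {a b : B} :
    basicOpen ll a ⊆ basicOpen ll b ↔ a ≤ b := by
  refine ⟨fun hab => ?_, basicOpen_mono⟩
  rw [← disjoint_compl_right_iff, disjoint_iff]
  by_contra hne
  obtain ⟨p, hp⟩ := h.basicOpen_nonempty_iff.2 hne
  rw [basicOpen_inf] at hp
  have hpb := p.inf_mem _ _ (hab hp.1) hp.2
  rw [inf_compl_eq_bot] at hpb
  exact p.bot_notMem hpb

/-- The elements non-tangentially containing an element whose basic closed set belongs to an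
ultrafilter on the space of points form a point. -/
def IsMVD.limitPoint (h : IsMVD ll) (F : Ultrafilter (Point ll)) {a : B} (ha : ll a ⊤)
    (haF : closure (basicOpen ll a) ∈ F) : Point ll where
  sets := {b | ∃ c, ll c b ∧ closure (basicOpen ll c) ∈ F}
  top_mem := ⟨a, ha, haF⟩
  bot_notMem := by
    rintro ⟨c, hc, hcF⟩
    rw [le_bot_iff.1 (h.le_of_ll _ _ hc), basicOpen_bot, closure_empty] at hcF
    exact F.empty_notMem hcF
  mem_of_le := by
    rintro b d ⟨c, hc, hcF⟩ hbd
    exact ⟨c, h.mono _ _ _ _ le_rfl hc hbd, hcF⟩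
  inf_mem := by
    rintro b b' ⟨c, hc, hcF⟩ ⟨c', hc', hcF'⟩
    obtain ⟨d, hcd, hdb⟩ := h.interpolate _ _ hc
    obtain ⟨d', hcd', hdb'⟩ := h.interpolate _ _ hc'
    refine ⟨d ⊓ d', h.ll_inf_inf hdb hdb', Filter.mem_of_superset ?_ subset_closure⟩
    rw [basicOpen_inf]
    exact Filter.inter_mem (Filter.mem_of_superset hcF (h.closure_basicOpen_subset hcd))
      (Filter.mem_of_superset hcF' (h.closure_basicOpen_subset hcd'))
  round := by
    rintro b ⟨c, hc, hcF⟩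
    obtain ⟨d, hcd, hdb⟩ := h.interpolate _ _ hc
    exact ⟨d, ⟨c, hcd, hcF⟩, hdb⟩
  prime e b heb := by
    obtain ⟨c, hec, hcb⟩ := h.interpolate _ _ heb
    obtain ⟨d, had, hdt⟩ := h.interpolate _ _ ha
    by_cases hcF : closure (basicOpen ll c) ∈ F
    · exact Or.inr ⟨c, hcb, hcF⟩
    · rw [← Ultrafilter.compl_mem_iff_notMem, h.closure_basicOpen, compl_compl] at hcF
      refine Or.inl ⟨d ⊓ cᶜ, h.inf_compl_ll_compl hec hdt,
        Filter.mem_of_superset ?_ subset_closure⟩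
      rw [basicOpen_inf]
      exact Filter.inter_mem (Filter.mem_of_superset haF (h.closure_basicOpen_subset had)) hcF

theorem IsMVD.isCompact_closure_basicOpen (h : IsMVD ll) {a : B} (ha : ll a ⊤) :
    IsCompact (closure (basicOpen ll a)) := by
  rw [isCompact_iff_ultrafilter_le_nhds']
  intro F haF
  have hle : (F : Filter (Point ll)) ≤ nhds (h.limitPoint F ha haF) := by
    refine isTopologicalBasis_basicOpen.nhds_hasBasis.ge_iff.2 ?_
    rintro _ ⟨⟨b, rfl⟩, c, hcb, hcF⟩
    exact Filter.mem_of_superset hcF (h.closure_basicOpen_subset hcb)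
  exact ⟨_, isClosed_closure.mem_of_frequently_of_tendsto
    (Filter.Eventually.frequently haF) hle, hle⟩

theorem IsMVD.ll_of_isCompact (h : IsMVD ll) {a b : B}
    (hc : IsCompact (closure (basicOpen ll a))) (hab : closure (basicOpen ll a) ⊆ basicOpen ll b) :
    ll a b := by
  -- By roundness the elements `c ≪ b` cover; finitely many suffice, and their join lies above `a`
  -- and is still `≪ b`.
  obtain ⟨t, ht⟩ := hc.elim_finite_subcover (fun c : {c // ll c b} => basicOpen ll c.1)
    (fun c => isOpen_basicOpen _) (fun p hp => by
      obtain ⟨c, hc, hcb⟩ := p.round b (hab hp)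
      exact Set.mem_iUnion.2 ⟨⟨c, hcb⟩, hc⟩)
  have hsup : ll (t.sup Subtype.val) b := by
    refine Finset.sup_induction (p := fun x => ll x b) (h.bot_ll b)
      (fun x hx y hy => h.sup_ll _ _ _ hx hy) (fun c _ => c.2)
  refine h.mono _ _ _ _ (h.basicOpen_subset_iff.1 ?_) hsup le_rfl
  refine subset_closure.trans (ht.trans (Set.iUnion₂_subset fun c hct => ?_))
  exact basicOpen_mono (Finset.le_sup (f := Subtype.val) hct)

theorem IsMVD.ll_iff (h : IsMVD ll) {a b : B} :
    ll a b ↔ IsCompact (closure (basicOpen ll a)) ∧ closure (basicOpen ll a) ⊆ basicOpen ll b :=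
  ⟨fun hab => ⟨h.isCompact_closure_basicOpen (h.ll_top hab), h.closure_basicOpen_subset hab⟩,
    fun hab => h.ll_of_isCompact hab.1 hab.2⟩

instance : T2Space (Point ll) := by
  have key : ∀ p q : Point ll, ∀ b ∈ p.sets, b ∉ q.sets →
      ∃ u v : Set (Point ll), IsOpen u ∧ IsOpen v ∧ p ∈ u ∧ q ∈ v ∧ Disjoint u v := by
    intro p q b hbp hbq
    obtain ⟨a, ha, hab⟩ := p.round b hbp
    refine ⟨basicOpen ll a, basicOpen ll aᶜ, isOpen_basicOpen _, isOpen_basicOpen _, ha,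
      (q.prime a b hab).resolve_right hbq, ?_⟩
    rw [Set.disjoint_iff_inter_eq_empty, ← basicOpen_inf, inf_compl_eq_bot, basicOpen_bot]
  refine ⟨fun p q hpq => ?_⟩
  have hne : p.sets ≠ q.sets := fun he => hpq (Point.ext he)
  by_cases hsub : p.sets ⊆ q.sets
  · obtain ⟨b, hbq, hbp⟩ := Set.not_subset.1 fun hs => hne (hsub.antisymm hs)
    obtain ⟨u, v, hu, hv, hqu, hpv, huv⟩ := key q p b hbq hbp
    exact ⟨v, u, hv, hu, hpv, hqu, huv.symm⟩
  · obtain ⟨b, hbp, hbq⟩ := Set.not_subset.1 hsub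
    exact key p q b hbp hbq

theorem IsMVD.locallyCompactSpace (h : IsMVD ll) : LocallyCompactSpace (Point ll) where
  local_compact_nhds p n hn := by
    obtain ⟨_, ⟨b, rfl⟩, hb, hbn⟩ := isTopologicalBasis_basicOpen.mem_nhds_iff.1 hn
    obtain ⟨a, ha, hab⟩ := p.round b hb
    exact ⟨closure (basicOpen ll a),
      Filter.mem_of_superset ((isOpen_basicOpen a).mem_nhds ha) subset_closure,
      (h.closure_basicOpen_subset hab).trans hbn, h.isCompact_closure_basicOpen (h.ll_top hab)⟩

theorem IsMVD.interior_closure_basicOpen (h : IsMVD ll) (a : B) :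
    interior (closure (basicOpen ll a)) = basicOpen ll a := by
  rw [h.closure_basicOpen, interior_compl, h.closure_basicOpen, compl_compl, compl_compl]

end Points

/-! ### Every complete MVD-algebra is represented by its space of points -/

section Representation

variable {B : Type u} [CompleteBooleanAlgebra B] {ll : B → B → Prop}

theorem IsMVD.exists_toSet_eq (h : IsMVD ll) (U : RegularOpen (Point ll)) :
    ∃ a, basicOpen ll a = U.toSet := by
  let S : Set B := {a | basicOpen ll a ⊆ U.toSet}
  have hU : U.toSet ⊆ basicOpen ll (sSup S) := fun p hp => by
    obtain ⟨_, ⟨a, rfl⟩, ha, haU⟩ := isTopologicalBasis_basicOpen.exists_subset_of_mem_open hp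
      U.isOpen
    exact basicOpen_mono (le_sSup haU) ha
  refine ⟨sSup S, Set.Subset.antisymm ?_ hU⟩
  rw [← U.interior_closure_toSet]
  refine interior_maximal (fun p hp => ?_) (isOpen_basicOpen _)
  rw [isTopologicalBasis_basicOpen.mem_closure_iff]
  rintro _ ⟨b, rfl⟩ hb
  by_contra hemp
  -- If `b` gave a neighbourhood of `p` missing `U`, it would be disjoint from every member of `S`,
  -- hence from the join, yet `p` contains both.
  have hS : sSup S ≤ bᶜ := sSup_le fun a ha => by
    rw [le_compl_iff_disjoint_right, disjoint_iff]
    by_contra hne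
    obtain ⟨q, hq⟩ := h.basicOpen_nonempty_iff.2 hne
    rw [basicOpen_inf] at hq
    exact hemp ⟨q, hq.2, ha hq.1⟩
  have hpb := p.inf_mem _ _ hb (p.mem_of_le _ _ hp hS)
  rw [inf_compl_eq_bot] at hpb
  exact p.bot_notMem hpb

/-- A complete MVD-algebra is order isomorphic to the regular open sets of its space of
points. -/
noncomputable def IsMVD.orderIso (h : IsMVD ll) : B ≃o RegularOpen (Point ll) :=
  RelIso.ofSurjective
    (OrderEmbedding.ofMapLEIff (fun a => RegularOpen.ofSet (basicOpen ll a)) fun a b => by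
      rw [RegularOpen.le_iff, RegularOpen.toSet_ofSet, RegularOpen.toSet_ofSet,
        h.interior_closure_basicOpen, h.interior_closure_basicOpen, h.basicOpen_subset_iff])
    fun U => by
      obtain ⟨a, ha⟩ := h.exists_toSet_eq U
      refine ⟨a, RegularOpen.toSet_injective ?_⟩
      change interior (closure (basicOpen ll a)) = _
      rw [h.interior_closure_basicOpen, ha]

theorem IsMVD.toSet_orderIso (h : IsMVD ll) (a : B) :
    (h.orderIso a).toSet = basicOpen ll a :=
  h.interior_closure_basicOpen a

end Representation

/-! ### Order isomorphisms as isomorphisms of MVD-algebras, and essential surjectivity -/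

theorem lowerAdjoint_orderIso {A B : Type u} [CompleteBooleanAlgebra A]
    [CompleteBooleanAlgebra B] (e : A ≃o B) (b : B) :
    lowerAdjoint (CompleteLatticeHom.OrderIso.toCompleteLatticeHom e) b = e.symm b :=
  (lowerAdjoint_gc (CompleteLatticeHom.OrderIso.toCompleteLatticeHom e)).l_unique
    e.symm.to_galoisConnection (fun _ => rfl)

/-- An order isomorphism preserving and reflecting `≪` is a morphism of MVD-algebras. -/
def IKA.homOfOrderIso {A B : IKA.{u}} (e : A.carrier ≃o B.carrier)
    (he : ∀ a b, B.ll (e a) (e b) ↔ A.ll a b) : A ⟶ B :=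
  IKA.Hom.mk (CompleteLatticeHom.OrderIso.toCompleteLatticeHom e)
    (fun a b hab d hd => by
      obtain ⟨c, rfl⟩ := e.surjective d
      rw [← map_top e, he] at hd
      have h1 := (he _ _).2 (hab c hd)
      rw [map_inf, map_sup, map_compl'] at h1
      exact h1)
    (fun b hb => by
      rw [lowerAdjoint_orderIso, ← he, e.apply_symm_apply, map_top]
      exact hb)

/-- An order isomorphism preserving and reflecting `≪` is an isomorphism of MVD-algebras. -/
def IKA.isoOfOrderIso {A B : IKA.{u}} (e : A.carrier ≃o B.carrier)
    (he : ∀ a b, B.ll (e a) (e b) ↔ A.ll a b) : A ≅ B where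
  hom := IKA.homOfOrderIso e he
  inv := IKA.homOfOrderIso e.symm fun a b => by
    rw [← he, e.apply_symm_apply, e.apply_symm_apply]
  hom_inv_id := IKA.Hom.ext (CompleteLatticeHom.ext fun a => e.symm_apply_apply a)
  inv_hom_id := IKA.Hom.ext (CompleteLatticeHom.ext fun a => e.apply_symm_apply a)

/-- The locally compact Hausdorff space of points of a complete MVD-algebra. -/
def IKA.pointSpace (A : IKA.{u}) : SKLC.{u} :=
  haveI := A.isMVD.locallyCompactSpace
  ⟨Point A.ll⟩

theorem IKA.boundedLL_orderIso_iff (A : IKA.{u}) (a b : A.carrier) :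
    boundedLL RegularOpen.contact (RegularOpen.relCompact _) (A.isMVD.orderIso a)
      (A.isMVD.orderIso b) ↔ A.ll a b := by
  rw [A.isMVD.ll_iff, boundedLL, RegularOpen.nonTangential_contact_iff, RegularOpen.relCompact,
    Set.mem_ofPred_eq, IsMVD.toSet_orderIso, IsMVD.toSet_orderIso]

instance : (regularOpenFunctor.{u} ⋙ skalToIKA).EssSurj where
  mem_essImage A := ⟨Opposite.op A.pointSpace,
    ⟨(IKA.isoOfOrderIso (B := (regularOpenFunctor ⋙ skalToIKA).obj (Opposite.op A.pointSpace))
      A.isMVD.orderIso A.boundedLL_orderIso_iff).symm⟩⟩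

/-- Fullness and faithfulness are inherited from the two factors, the second being an equivalence.
-/
instance : (regularOpenFunctor.{u} ⋙ skalToIKA).IsEquivalence where

end RegionBased

theorem mainTheorem2 :
    (∃ (K : RegionBased.SKAL.{u} ⥤ RegionBased.IKA.{u})
        (Θ : RegionBased.IKA.{u} ⥤ RegionBased.SKAL.{u}),
      K ⋙ Θ = 𝟭 RegionBased.SKAL.{u} ∧ Θ ⋙ K = 𝟭 RegionBased.IKA.{u}) ∧
    Nonempty (RegionBased.SKLC.{u}ᵒᵖ ≌ RegionBased.IKA.{u}) := by
  exact ⟨⟨RegionBased.skalToIKA, RegionBased.ikaToSKAL, RegionBased.skalToIKA_comp_ikaToSKAL,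
      RegionBased.ikaToSKAL_comp_skalToIKA⟩,
    ⟨(RegionBased.regularOpenFunctor ⋙ RegionBased.skalToIKA).asEquivalence⟩⟩
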